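/- Let $N,p\ge 0$ be integers, and let $(x^{(i)},y^{(i)})\in\mathbb R^p\times\mathbb R$, $i=1,\dots,N$, be data of full rank, in the sense that no proper affine subspace of $\mathbb R^p$ contains all the predictor points $x^{(1)},\dots,x^{(N)}$. Let $$f(\beta_0,\beta)=\tfrac12\sum_{i=1}^N\Big(y^{(i)}-\beta_0-\sum_{j=1}^p\beta_jx^{(i)}_j\Big)^2,\qquad \|\beta\|_1=\sum_{j=1}^p|\beta_j| ,$$ and, with means $\bar x_j=\frac1N\sum_i x^{(i)}_j$, $\bar y=\frac1N\sum_i y^{(i)}$, let $$(K_1)_{jl}=\tfrac1N\sum_{i}(x_j^{(i)}-\bar x_j)(x_l^{(i)}-\bar x_l),\qquad b_j=\tfrac1N\sum_i(x_j^{(i)}-\bar x_j)(y^{(i)}-\bar y),\qquad \hat\beta=K_1^{-1}b,\qquad \hat t=\|\hat\beta\|_1 .$$ A lasso solution for $t\ge0$ is a vector $\beta\in\mathbb R^p$ such that, for some $\beta_0$, $(\beta_0,\beta)$ minimizes $f$ under the constraint $\|\beta\|_1\le t$. A lasso solution with parameter $s$ is a lasso solution $\beta$ for some $t>0$ such that $(K_1\beta-b)_j=s\,\operatorname{sign}(\beta_j)$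 for all $j$ with $\beta_j\neq0$. For nonempty $A\subseteq\{1,\dots,p\}$ the lasso problem induced on the coordinate face $\{\beta:\beta_j=0\text{ for }j\notin A\}$ is the lasso problem that uses only the predictors in $A$; its matrix and vector are the restrictions $K_A$, $b_A$ of $K_1$, $b$, and its center is $K_A^{-1}b_A$ (for $A=\{1,\dots,p\}$ it is the original problem, with center $\hat\beta$). Its rays are the sets $\{K_A^{-1}b_A+sK_A^{-1}\delta: s\le 0\}$ with $\delta\in\{\pm1\}^A$, regarded as subsets of $\mathbb R^p$ by setting the other coordinates to zero. Then $\hat\beta$ is the unique vector of slopes of an unconstrained minimizer of $f$, and there are $\hat s\le0$ and a map $\beta:[\hat s,0]\to\mathbb R^p$ such that the following hold. 1. For every $s\in(\hat s,0]$, $\beta(s)$ is the unique lasso solution with parameter $s$. The function $s\mapsto\|\beta(s)\|_1$ is strictly increasing from $[\hat s,0]$ onto $[0,\hat t]$, and for every $s\in[\hat s,0]$, $\beta(s)$ is the unique lasso solution for $t=\|\beta(s)\|_1$. 2. There are $0=\sigma_0>\sigma_1>\dots>\sigma_m=\hat s$ such that $v_i=\beta(\sigma_i)$ are the vertices of a simple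 polygonal chain (its segments $[v_i,v_{i+1}]$ are nondegenerate, consecutive segments meet only in their common vertex, and non-consecutive segments are disjoint) with $v_0=\hat\beta$ and $v_m=0$, and $\beta([\hat s,0])$ is this chain. (If $\hat\beta=0$, then $m=0$ and the chain is a point.) 3. No two of the segments lie on parallel or equal lines. 4. For every $i<m$ there are a nonempty $A\subseteq\{1,\dots,p\}$ and $\delta\in\{\pm1\}^A$ such that the segment $[v_i,v_{i+1}]$ lies on the ray of the lasso problem induced on the face of $A$ that belongs to $\delta$. Moreover $\beta(s)=K_A^{-1}b_A+sK_A^{-1}\delta$ (extended by zero) for $s\in[\sigma_{i+1},\sigma_i]$, and for $s\in(\sigma_{i+1},\sigma_i)$ the coordinates $\beta_j(s)$, $j\in A$, are nonzero with signs $\delta_j$. -/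

import Mathlib

noncomputable section

namespace Lasso

/-! ### Data, least squares, and the lasso

A data set consists of `N` points: predictors `x i : J → ℝ` and responses `y i : ℝ`.
The predictors are indexed by an arbitrary finite type `J`, so that the same definitions apply
to a problem in `p` predictors and to the problem induced on a subset of the predictors. -/

variable {N : ℕ} {J : Type*} [Fintype J] [DecidableEq J]

/-- The arithmetic mean of `N` numbers. -/
def mean (z : Fin N → ℝ) : ℝ := (∑ i, z i) / N

/-- The covariance matrix `K₁` of the predictors (masses `1 / N`, taken about the centroid). -/
def covMatrix (x : Fin N → J → ℝ) : Matrix J J ℝ :=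
  fun j l => mean fun i => (x i j - mean fun k => x k j) * (x i l - mean fun k => x k l)

/-- The vector `b` of covariances of the predictors with the response. -/
def covVector (x : Fin N → J → ℝ) (y : Fin N → ℝ) : J → ℝ :=
  fun j => mean fun i => (x i j - mean fun k => x k j) * (y i - mean y)

/-- Full rank: the predictor points lie in no affine subspace of smaller dimension. -/
def FullRank (x : Fin N → J → ℝ) : Prop :=
  affineSpan ℝ (Set.range x) = ⊤

/-- The least square objective function, with intercept `β₀`. -/
def objective (x : Fin N → J → ℝ) (y : Fin N → ℝ) (β₀ : ℝ) (β : J → ℝ) : ℝ :=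
  1 / 2 * ∑ i, (y i - β₀ - ∑ j, β j * x i j) ^ 2

/-- The `ℓ¹` norm. -/
def l1 (β : J → ℝ) : ℝ := ∑ j, |β j|

/-- `β` is the vector of slopes of an unconstrained minimizer of the objective function. -/
def IsLeastSquares (x : Fin N → J → ℝ) (y : Fin N → ℝ) (β : J → ℝ) : Prop :=
  ∃ β₀ : ℝ, ∀ (γ₀ : ℝ) (γ : J → ℝ), objective x y β₀ β ≤ objective x y γ₀ γ

/-- `β` is the vector of slopes of a minimizer of the objective function under the constraint
`‖β‖₁ ≤ t`; the intercept is not constrained. -/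
def IsLassoSolution (x : Fin N → J → ℝ) (y : Fin N → ℝ) (t : ℝ) (β : J → ℝ) : Prop :=
  l1 β ≤ t ∧ ∃ β₀ : ℝ, ∀ (γ₀ : ℝ) (γ : J → ℝ), l1 γ ≤ t →
    objective x y β₀ β ≤ objective x y γ₀ γ

/-- `β` is the lasso solution with parameter `s`: it is a lasso solution for some `t > 0`, and the
gradient `K₁ β - b` of the equimomental ellipsoid, projected to the coordinates on which `β` does
not vanish, is `s` times the vector of signs of `β`. -/
def IsLassoSolutionAt (x : Fin N → J → ℝ) (y : Fin N → ℝ) (s : ℝ) (β : J → ℝ) : Prop :=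
  (∃ t : ℝ, 0 < t ∧ IsLassoSolution x y t β) ∧
    ∀ j, β j ≠ 0 →
      ((covMatrix x).mulVec β - covVector x y) j = s * Real.sign (β j)

/-- The common center `β̂ = K₁⁻¹ b` of the equimomental ellipsoids. -/
def center (x : Fin N → J → ℝ) (y : Fin N → ℝ) : J → ℝ :=
  (covMatrix x)⁻¹.mulVec (covVector x y)

/-- The point with parameter `s` on the line through the center with direction `K₁⁻¹ δ`. -/
def rayPoint (x : Fin N → J → ℝ) (y : Fin N → ℝ) (δ : J → ℝ) (s : ℝ) : J → ℝ :=
  center x y + s • (covMatrix x)⁻¹.mulVec δ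

/-- The ray of the lasso problem `(x, y)` that belongs to the sign vector `δ`. It starts at the
center and consists of the points `β` with `K₁ β - b = s δ` for some `s ≤ 0`. -/
def ray (x : Fin N → J → ℝ) (y : Fin N → ℝ) (δ : J → ℝ) : Set (J → ℝ) :=
  rayPoint x y δ '' Set.Iic 0

/-- The predictors of the lasso problem induced on the coordinate face
`{β | ∀ j ∉ A, β j = 0}`. Its covariance matrix is obtained from `K₁` by omitting the rows and
columns outside `A`; for `A = Finset.univ` it is the original problem. -/
def induced (x : Fin N → J → ℝ) (A : Finset J) : Fin N → A → ℝ :=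
  fun i j => x i j

/-- The inclusion of a coordinate face: extension by zero. -/
def extendZero (A : Finset J) (u : A → ℝ) : J → ℝ :=
  fun j => if h : j ∈ A then u ⟨j, h⟩ else 0

end Lasso

/-! ### Polygonal chains -/

namespace PolygonalChain

variable {E : Type*} [AddCommGroup E] [Module ℝ E] {m : ℕ}

/-- The `i`-th segment of the polygonal chain with vertices `v 0, …, v m`. -/
def edge (v : Fin (m + 1) → E) (i : Fin m) : Set E :=
  segment ℝ (v i.castSucc) (v i.succ)

/-- The set of points of a polygonal chain (a single point if there are no segments). -/
def trace (v : Fin (m + 1) → E) : Set E :=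
  Set.range v ∪ ⋃ i, edge v i

/-- A simple polygonal chain: segments are nondegenerate, consecutive segments meet only in their
common vertex, and other segments do not meet. -/
structure IsSimple (v : Fin (m + 1) → E) : Prop where
  nondegenerate : ∀ i : Fin m, v i.castSucc ≠ v i.succ
  consecutive : ∀ i j : Fin m, (j : ℕ) = i + 1 → edge v i ∩ edge v j = {v i.succ}
  disjoint : ∀ i j : Fin m, (i : ℕ) + 1 < j → Disjoint (edge v i) (edge v j)

/-- No two segments lie on parallel (or equal) lines. -/
def NoParallel (v : Fin (m + 1) → E) : Prop :=
  ∀ i j : Fin m, i ≠ j →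
    ¬ (affineSpan ℝ {v i.castSucc, v i.succ}).Parallel (affineSpan ℝ {v j.castSucc, v j.succ})

end PolygonalChain

end

noncomputable section

namespace Lasso

open Matrix

/-! ### The `ℓ¹` norm and positive definite quadratic forms -/

section Quadratic

variable {J : Type*} [Fintype J]

lemma l1_nonneg (β : J → ℝ) : 0 ≤ l1 β := Finset.sum_nonneg fun _ _ => abs_nonneg _

lemma l1_zero : l1 (0 : J → ℝ) = 0 := by simp [l1]

lemma l1_eq_zero {β : J → ℝ} : l1 β = 0 ↔ β = 0 := by
  rw [l1, Finset.sum_eq_zero_iff_of_nonneg fun _ _ => abs_nonneg _]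
  simp [funext_iff]

lemma l1_add_le (β γ : J → ℝ) : l1 (β + γ) ≤ l1 β + l1 γ := by
  simp only [l1, ← Finset.sum_add_distrib]
  exact Finset.sum_le_sum fun j _ => abs_add_le _ _

lemma l1_smul (c : ℝ) (β : J → ℝ) : l1 (c • β) = |c| * l1 β := by
  simp [l1, Finset.mul_sum, abs_mul]

lemma continuous_l1 : Continuous (l1 : (J → ℝ) → ℝ) := by
  unfold l1; fun_prop

lemma norm_le_l1 (β : J → ℝ) : ‖β‖ ≤ l1 β :=
  (pi_norm_le_iff_of_nonneg (l1_nonneg β)).2 fun j =>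
    Finset.single_le_sum (f := fun j => |β j|) (fun _ _ => abs_nonneg _) (Finset.mem_univ j)

lemma l1_le_card_mul_norm (β : J → ℝ) : l1 β ≤ Fintype.card J * ‖β‖ := by
  refine (Finset.sum_le_card_nsmul _ _ ‖β‖ fun j _ => norm_le_pi_norm β j).trans ?_
  simp

lemma PosDef_pos {K : Matrix J J ℝ} (hK : K.PosDef) {v : J → ℝ} (hv : v ≠ 0) :
    0 < v ⬝ᵥ K *ᵥ v := by
  simpa using hK.dotProduct_mulVec_pos hv

lemma PosDef_nonneg {K : Matrix J J ℝ} (hK : K.PosDef) (v : J → ℝ) :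
    0 ≤ v ⬝ᵥ K *ᵥ v := by
  rcases eq_or_ne v 0 with rfl | hv
  · simp
  · exact (PosDef_pos hK hv).le

lemma PosDef_eq_zero {K : Matrix J J ℝ} (hK : K.PosDef) {v : J → ℝ}
    (hv : v ⬝ᵥ K *ᵥ v ≤ 0) : v = 0 := by
  by_contra h
  exact absurd (PosDef_pos hK h) hv.not_gt

lemma PosDef_comm {K : Matrix J J ℝ} (hK : K.PosDef) (v w : J → ℝ) :
    v ⬝ᵥ K *ᵥ w = w ⬝ᵥ K *ᵥ v := by
  have h : Kᵀ = K := by simpa using hK.isHermitian.eq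
  rw [dotProduct_mulVec, ← mulVec_transpose, h, dotProduct_comm]

lemma exists_mul_norm_sq_le {K : Matrix J J ℝ} (hK : K.PosDef) :
    ∃ c > 0, ∀ v : J → ℝ, c * ‖v‖ ^ 2 ≤ v ⬝ᵥ K *ᵥ v := by
  rcases (Metric.sphere (0 : J → ℝ) 1).eq_empty_or_nonempty with h | h
  · refine ⟨1, one_pos, fun v => ?_⟩
    rcases eq_or_ne v 0 with rfl | hv
    · simp
    · refine absurd h (Set.Nonempty.ne_empty ⟨‖v‖⁻¹ • v, ?_⟩)
      simp [norm_smul, hv]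
  · obtain ⟨u, hu, hmin⟩ := (isCompact_sphere (0 : J → ℝ) 1).exists_isMinOn h
      (f := fun v => v ⬝ᵥ K *ᵥ v) (by fun_prop)
    have hu0 : u ≠ 0 := by rintro rfl; simp at hu
    refine ⟨_, PosDef_pos hK hu0, fun v => ?_⟩
    rcases eq_or_ne v 0 with rfl | hv
    · simp
    · have hn : ‖v‖ ≠ 0 := norm_ne_zero_iff.2 hv
      have := hmin (a := ‖v‖⁻¹ • v) (by simp [norm_smul, hv])
      simp only [Set.mem_ofPred_eq, mulVec_smul, smul_dotProduct, dotProduct_smul,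
        smul_eq_mul] at this
      calc _ ≤ (‖v‖⁻¹ * (‖v‖⁻¹ * (v ⬝ᵥ K *ᵥ v))) * ‖v‖ ^ 2 := by gcongr
        _ = _ := by field_simp

/-- The quadratic part of the least square objective function. -/
def quad (K : Matrix J J ℝ) (b β : J → ℝ) : ℝ := 1 / 2 * (β ⬝ᵥ K *ᵥ β) - b ⬝ᵥ β

lemma quad_sub {K : Matrix J J ℝ} (hK : K.PosDef) (b β γ : J → ℝ) :
    quad K b γ - quad K b β =
      (K *ᵥ β - b) ⬝ᵥ (γ - β) + 1 / 2 * ((γ - β) ⬝ᵥ K *ᵥ (γ - β)) := by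
  have h := PosDef_comm hK β γ
  have h2 := dotProduct_comm (K *ᵥ β) γ
  have h3 := dotProduct_comm (K *ᵥ β) β
  simp only [quad, mulVec_sub, dotProduct_sub, sub_dotProduct] at *
  linarith

end Quadratic

/-! ### The optimality conditions -/

section PathPoint

variable {J : Type*} [Fintype J] {K : Matrix J J ℝ} {b β γ : J → ℝ} {s t : ℝ}

/-- The optimality conditions of the `ℓ¹`-penalized problem with multiplier `-s`. -/
structure IsPathPoint (K : Matrix J J ℝ) (b : J → ℝ) (s : ℝ) (β : J → ℝ) : Prop where
  abs_le : ∀ j, |(K *ᵥ β - b) j| ≤ -s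
  mul_eq : ∀ j, (K *ᵥ β - b) j * β j = s * |β j|

lemma isPathPoint_zero_iff (b : J → ℝ) (hs : s ≤ 0) : IsPathPoint K b s 0 ↔ s ≤ -‖b‖ := by
  constructor
  · intro h
    have : ‖b‖ ≤ -s := (pi_norm_le_iff_of_nonneg (by linarith)).2 fun j => by
      simpa using h.abs_le j
    linarith
  · intro h
    refine ⟨fun j => ?_, fun j => by simp⟩
    have := norm_le_pi_norm b j
    simp only [Real.norm_eq_abs] at this
    simp only [mulVec_zero, zero_sub, Pi.neg_apply, abs_neg]
    linarith

namespace IsPathPoint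

lemma dotProduct_self (h : IsPathPoint K b s β) : (K *ᵥ β - b) ⬝ᵥ β = s * l1 β := by
  simp only [dotProduct, l1, Finset.mul_sum, h.mul_eq]

lemma le_dotProduct (h : IsPathPoint K b s β) (γ : J → ℝ) :
    s * l1 γ ≤ (K *ᵥ β - b) ⬝ᵥ γ := by
  simp only [dotProduct, l1, Finset.mul_sum]
  refine Finset.sum_le_sum fun j _ => ?_
  have h1 := mul_le_mul_of_nonneg_right (h.abs_le j) (abs_nonneg (γ j))
  rw [← abs_mul] at h1
  linarith [neg_abs_le ((K *ᵥ β - b) j * γ j)]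

lemma dotProduct_mulVec_le (h : IsPathPoint K b s β) (h' : IsPathPoint K b t γ) :
    (γ - β) ⬝ᵥ K *ᵥ (γ - β) ≤ (t - s) * (l1 γ - l1 β) := by
  have e : (γ - β) ⬝ᵥ K *ᵥ (γ - β) = (K *ᵥ γ - b) ⬝ᵥ γ - (K *ᵥ γ - b) ⬝ᵥ β
      - (K *ᵥ β - b) ⬝ᵥ γ + (K *ᵥ β - b) ⬝ᵥ β := by
    rw [dotProduct_comm]
    simp only [mulVec_sub, dotProduct_sub, sub_dotProduct]
    ring
  rw [e, h.dotProduct_self, h'.dotProduct_self]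
  linarith [h.le_dotProduct γ, h'.le_dotProduct β]

lemma unique (hK : K.PosDef) (h : IsPathPoint K b s β) (h' : IsPathPoint K b s γ) : γ = β :=
  sub_eq_zero.1 (PosDef_eq_zero hK (by simpa using h.dotProduct_mulVec_le h'))

lemma gradient_eq (h : IsPathPoint K b s β) {j : J} (hj : β j ≠ 0) :
    (K *ᵥ β - b) j = s * SignType.sign (β j) := by
  have := h.mul_eq j
  rw [← sign_mul_self (β j), ← mul_assoc] at this
  exact mul_right_cancel₀ hj this

/-- A path point minimizes the quadratic function under its own `ℓ¹` constraint. -/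
lemma quad_add_le (hK : K.PosDef) (hs : s ≤ 0) (h : IsPathPoint K b s β) (hγ : l1 γ ≤ l1 β) :
    quad K b β + 1 / 2 * ((γ - β) ⬝ᵥ K *ᵥ (γ - β)) ≤ quad K b γ := by
  have e := quad_sub hK b β γ
  rw [dotProduct_sub, h.dotProduct_self] at e
  nlinarith [h.le_dotProduct γ]

/-- The `ℓ¹` norm is strictly increasing along the path, up to the parameter at which the
path reaches the origin. -/
lemma l1_lt_l1 (hK : K.PosDef) (h : IsPathPoint K b s β) (h' : IsPathPoint K b t γ)
    (hs : -‖b‖ ≤ s) (hst : s < t) (ht : t ≤ 0) : l1 β < l1 γ := by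
  have key := h.dotProduct_mulVec_le h'
  rcases eq_or_ne γ β with rfl | hne
  · by_cases h0 : γ = 0
    · subst h0
      linarith [(isPathPoint_zero_iff b ht).1 h']
    · obtain ⟨j, hj⟩ := Function.ne_iff.1 h0
      have e := h.mul_eq j
      rw [h'.mul_eq j] at e
      have := mul_right_cancel₀ (abs_ne_zero.2 hj) e
      linarith
  · have := PosDef_pos hK (sub_ne_zero.2 hne)
    by_contra hc
    nlinarith

end IsPathPoint

lemma isPathPoint_of_forall (hs : s ≤ 0)
    (h : ∀ γ, s * (l1 γ - l1 β) ≤ (K *ᵥ β - b) ⬝ᵥ (γ - β)) : IsPathPoint K b s β := by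
  classical
  have h1 : ∀ j c, s * |c| ≤ (K *ᵥ β - b) j * c := fun j c => by
    have h2 := h (β + Pi.single j c)
    have h3 : l1 (Pi.single j c : J → ℝ) = |c| := by
      rw [l1, Finset.sum_eq_single j] <;> simp +contextual
    rw [add_sub_cancel_left, dotProduct_single] at h2
    nlinarith [l1_add_le β (Pi.single j c)]
  refine ⟨fun j => ?_, ?_⟩
  · have h2 := h1 j 1
    have h3 := h1 j (-1)
    simp only [abs_neg, abs_one] at h2 h3
    exact abs_le.2 ⟨by linarith, by linarith⟩
  · have h2 := h 0
    rw [l1_zero, zero_sub, zero_sub, dotProduct_neg] at h2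
    have h3 : ∑ j, s * |β j| = ∑ j, (K *ᵥ β - b) j * β j := by
      refine le_antisymm (Finset.sum_le_sum fun j _ => h1 j (β j)) ?_
      rw [← Finset.mul_sum]
      simp only [dotProduct, l1] at h2 ⊢
      linarith
    intro j
    exact ((Finset.sum_eq_sum_iff_of_le fun j _ => h1 j (β j)).1 h3 j (Finset.mem_univ j)).symm

lemma nonneg_of_forall_add_mul {a c : ℝ} (h : ∀ ε ∈ Set.Ioc (0 : ℝ) 1, 0 ≤ a + ε * c) : 0 ≤ a := by
  by_contra! ha
  have hc : 0 < |c| + 1 := by positivity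
  have h1 : 0 < -a / (|c| + 1) := div_pos (by linarith) hc
  have h2 := h (min 1 (-a / (|c| + 1) / 2)) ⟨lt_min one_pos (by linarith), min_le_left _ _⟩
  set ε := min 1 (-a / (|c| + 1) / 2) with hε
  have h3 : 0 < ε := lt_min one_pos (by linarith)
  have h4 : ε * (|c| + 1) ≤ -a / 2 := by
    calc _ ≤ (-a / (|c| + 1) / 2) * (|c| + 1) := by gcongr; exact min_le_right _ _
      _ = _ := by field_simp
  nlinarith [le_abs_self c]

lemma exists_isPathPoint (hK : K.PosDef) {c : J → ℝ} (hc : K *ᵥ c = b) (hs : s ≤ 0) :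
    ∃ β, IsPathPoint K b s β := by
  rcases hs.eq_or_lt with rfl | hs'
  · exact ⟨c, fun j => by simp [hc], fun j => by simp [hc]⟩
  have hcont : Continuous fun β : J → ℝ => quad K b β - s * l1 β := by
    unfold quad
    have := continuous_l1 (J := J)
    fun_prop
  have hlim : Filter.Tendsto (fun β : J → ℝ => quad K b β - s * l1 β)
      (Filter.cocompact (J → ℝ)) Filter.atTop := by
    have h1 : Filter.Tendsto (fun β : J → ℝ => quad K b c + -s * ‖β‖)
        (Filter.cocompact (J → ℝ)) Filter.atTop :=
      Filter.tendsto_atTop_add_const_left _ _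
        ((tendsto_norm_cocompact_atTop).const_mul_atTop (by linarith))
    refine Filter.tendsto_atTop_mono (fun β => ?_) h1
    have e := quad_sub hK b c β
    rw [hc, sub_self, zero_dotProduct] at e
    nlinarith [PosDef_nonneg hK (β - c), norm_le_l1 β]
  obtain ⟨β, hβ⟩ := hcont.exists_forall_le hlim
  refine ⟨β, isPathPoint_of_forall hs fun γ => ?_⟩
  rw [← sub_nonneg]
  refine nonneg_of_forall_add_mul (c := 1 / 2 * ((γ - β) ⬝ᵥ K *ᵥ (γ - β))) fun ε hε => ?_
  have h1 := hβ (β + ε • (γ - β))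
  have h2 := quad_sub hK b β (β + ε • (γ - β))
  have h3 : l1 (β + ε • (γ - β)) ≤ (1 - ε) * l1 β + ε * l1 γ := by
    have e : β + ε • (γ - β) = (1 - ε) • β + ε • γ := by module
    rw [e]
    refine (l1_add_le _ _).trans_eq ?_
    rw [l1_smul, l1_smul, abs_of_nonneg hε.1.le, abs_of_nonneg (sub_nonneg.2 hε.2)]
  rw [add_sub_cancel_left, mulVec_smul, dotProduct_smul, smul_dotProduct, dotProduct_smul] at h2
  simp only [smul_eq_mul] at h2
  refine nonneg_of_mul_nonneg_right ?_ hε.1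
  nlinarith

/-- The path through the points that satisfy the optimality conditions. -/
def path (K : Matrix J J ℝ) (b : J → ℝ) (s : ℝ) : J → ℝ := by
  classical
  exact if h : ∃ β, IsPathPoint K b s β then h.choose else 0

section Path

variable [DecidableEq J]

lemma path_spec (hK : K.PosDef) (hs : s ≤ 0) : IsPathPoint K b s (path K b s) := by
  have h : ∃ β, IsPathPoint K b s β :=
    exists_isPathPoint hK (c := K⁻¹ *ᵥ b)
      (by rw [mulVec_mulVec, mul_nonsing_inv _ ((isUnit_iff_isUnit_det _).1 hK.isUnit),
        one_mulVec]) hs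
  rw [path, dif_pos h]
  exact h.choose_spec

lemma IsPathPoint.eq_path (hK : K.PosDef) (hs : s ≤ 0) (h : IsPathPoint K b s β) :
    path K b s = β := h.unique hK (path_spec hK hs)

lemma path_zero (hK : K.PosDef) : path K b 0 = K⁻¹ *ᵥ b := by
  refine IsPathPoint.eq_path hK le_rfl ?_
  have h : K *ᵥ K⁻¹ *ᵥ b = b := by
    rw [mulVec_mulVec, mul_nonsing_inv _ ((isUnit_iff_isUnit_det _).1 hK.isUnit), one_mulVec]
  exact ⟨fun j => by simp [h], fun j => by simp [h]⟩

lemma path_neg_norm (hK : K.PosDef) : path K b (-‖b‖) = 0 :=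
  IsPathPoint.eq_path hK (by simp) ((isPathPoint_zero_iff b (by simp)).2 le_rfl)

lemma path_ne_zero (hK : K.PosDef) (hs : s ∈ Set.Ioc (-‖b‖) 0) : path K b s ≠ 0 := fun h => by
  have h1 := path_spec (b := b) hK hs.2
  rw [h, isPathPoint_zero_iff b hs.2] at h1
  exact absurd hs.1 h1.not_gt

lemma strictMonoOn_l1_path (hK : K.PosDef) :
    StrictMonoOn (fun s => l1 (path K b s)) (Set.Icc (-‖b‖) 0) := fun _ hs _ ht hst =>
  (path_spec hK hs.2).l1_lt_l1 hK (path_spec hK ht.2) hs.1 hst ht.2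

lemma injOn_path (hK : K.PosDef) : Set.InjOn (path K b) (Set.Icc (-‖b‖) 0) :=
  fun _ hs _ ht h => (strictMonoOn_l1_path hK).injOn hs ht (congrArg l1 h)

lemma continuousOn_path (hK : K.PosDef) : ContinuousOn (path K b) (Set.Iic 0) := by
  obtain ⟨c, hc, hcK⟩ := exists_mul_norm_sq_le hK
  have hL : 0 ≤ (Fintype.card J : ℝ) / c := by positivity
  refine (LipschitzOnWith.of_dist_le_mul (K := ⟨_, hL⟩) fun s hs t ht => ?_).continuousOn
  have h1 := (path_spec (b := b) hK ht).dotProduct_mulVec_le (path_spec hK hs)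
  set u := path K b s
  set v := path K b t
  have h2 := hcK (u - v)
  have h3 : (s - t) * (l1 u - l1 v) ≤ |s - t| * (Fintype.card J * ‖u - v‖) := by
    refine (le_abs_self _).trans ?_
    rw [abs_mul]
    refine mul_le_mul_of_nonneg_left (le_trans ?_ (l1_le_card_mul_norm (u - v))) (abs_nonneg _)
    have e1 := l1_add_le (u - v) v
    have e2 := l1_add_le (v - u) u
    have e3 : l1 (v - u) = l1 (u - v) := by
      rw [← neg_sub, ← neg_one_smul ℝ, l1_smul]; simp
    rw [sub_add_cancel] at e1 e2
    exact abs_le.2 ⟨by linarith, by linarith⟩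
  rw [dist_eq_norm, Real.dist_eq]
  change ‖u - v‖ ≤ Fintype.card J / c * |s - t|
  rcases (norm_nonneg (u - v)).eq_or_lt with h0 | h0
  · rw [← h0]; positivity
  · rw [div_mul_eq_mul_div, le_div_iff₀ hc]
    refine le_of_mul_le_mul_right ?_ h0
    nlinarith

lemma image_l1_path (hK : K.PosDef) :
    (fun s => l1 (path K b s)) '' Set.Icc (-‖b‖) 0 = Set.Icc 0 (l1 (K⁻¹ *ᵥ b)) := by
  have h0 : -‖b‖ ≤ 0 := by simp
  have hc : ContinuousOn (fun s => l1 (path K b s)) (Set.Icc (-‖b‖) 0) :=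
    continuous_l1.comp_continuousOn ((continuousOn_path hK).mono Set.Icc_subset_Iic_self)
  apply Set.Subset.antisymm
  · rintro _ ⟨s, hs, rfl⟩
    refine ⟨l1_nonneg _, ?_⟩
    rw [← path_zero hK]
    exact (strictMonoOn_l1_path hK).monotoneOn hs ⟨h0, le_rfl⟩ hs.2
  · have := intermediate_value_Icc h0 hc
    simpa only [path_zero hK, path_neg_norm hK, l1_zero] using this

end Path

end PathPoint

section Pattern

variable {J : Type*} {K : Matrix J J ℝ} {b β γ : J → ℝ} {s t : ℝ}

/-- The vector of signs of the coordinates. -/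
def pattern (β : J → ℝ) : J → SignType := fun j => SignType.sign (β j)

lemma pattern_apply_eq_zero {j : J} : pattern β j = 0 ↔ β j = 0 := sign_eq_zero_iff

lemma pattern_add_smul {a c : ℝ} (ha : 0 ≤ a) (hc : 0 ≤ c) (hac : a + c = 1)
    (h : pattern β = pattern γ) : pattern (a • β + c • γ) = pattern β := by
  funext j
  have hj : SignType.sign (β j) = SignType.sign (γ j) := congrFun h j
  simp only [pattern, Pi.add_apply, Pi.smul_apply, smul_eq_mul]
  rcases lt_trichotomy (β j) 0 with h0 | h0 | h0
  · have h1 : γ j < 0 := by rwa [sign_neg h0, eq_comm, sign_eq_neg_one_iff] at hj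
    rw [sign_neg h0, sign_eq_neg_one_iff]
    exact convex_Iio (0 : ℝ) h0 h1 ha hc hac
  · have h1 : γ j = 0 := by rwa [h0, sign_zero, eq_comm, sign_eq_zero_iff] at hj
    simp [h0, h1]
  · have h1 : 0 < γ j := by rwa [sign_pos h0, eq_comm, sign_eq_one_iff] at hj
    rw [sign_pos h0, sign_eq_one_iff]
    exact convex_Ioi (0 : ℝ) h0 h1 ha hc hac

variable [Fintype J]

lemma IsPathPoint.add_smul (h : IsPathPoint K b s β) (h' : IsPathPoint K b t γ)
    {a c : ℝ} (ha : 0 ≤ a) (hc : 0 ≤ c) (hac : a + c = 1) (hp : pattern β = pattern γ) :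
    IsPathPoint K b (a * s + c * t) (a • β + c • γ) := by
  have e : ∀ j, (K *ᵥ (a • β + c • γ) - b) j =
      a * (K *ᵥ β - b) j + c * (K *ᵥ γ - b) j := fun j => by
    simp only [mulVec_add, mulVec_smul, Pi.sub_apply, Pi.add_apply, Pi.smul_apply, smul_eq_mul]
    linear_combination (b j) * hac
  have hp' := pattern_add_smul ha hc hac hp
  refine ⟨fun j => ?_, fun j => ?_⟩
  · rw [e]
    have h1 := _root_.abs_le.1 (h.abs_le j)
    have h2 := _root_.abs_le.1 (h'.abs_le j)
    exact _root_.abs_le.2 ⟨by nlinarith, by nlinarith⟩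
  · by_cases h0 : (a • β + c • γ) j = 0
    · simp [h0]
    · have h1 : β j ≠ 0 := fun h1 =>
        h0 (pattern_apply_eq_zero.1 (by rw [hp', pattern_apply_eq_zero, h1]))
      have h2 : γ j ≠ 0 := fun h2 =>
        h1 (pattern_apply_eq_zero.1 (by rw [hp, pattern_apply_eq_zero, h2]))
      have e1 : SignType.sign (γ j) = SignType.sign (β j) := (congrFun hp j).symm
      have e2 : SignType.sign ((a • β + c • γ) j) = SignType.sign (β j) := congrFun hp' j
      rw [e, h.gradient_eq h1, h'.gradient_eq h2, e1, ← sign_mul_self ((a • β + c • γ) j), e2]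
      ring

lemma IsPathPoint.l1_eq (hK : K.PosDef) (h : IsPathPoint K b s β) {d : J → ℝ}
    (hd : ∀ j, β j = 0 → d j = 0) (hKd : ∀ j, β j ≠ 0 → (K *ᵥ d) j = SignType.sign (β j)) :
    l1 β = d ⬝ᵥ b + s * (d ⬝ᵥ K *ᵥ d) := by
  have h1 : d ⬝ᵥ K *ᵥ β = l1 β := by
    rw [PosDef_comm hK]
    refine Finset.sum_congr rfl fun j _ => ?_
    by_cases h0 : β j = 0
    · simp [h0]
    · rw [hKd j h0, self_mul_sign]
  have h2 : d ⬝ᵥ (K *ᵥ β - b) = s * (d ⬝ᵥ K *ᵥ d) := by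
    simp only [dotProduct, Finset.mul_sum]
    refine Finset.sum_congr rfl fun j _ => ?_
    by_cases h0 : β j = 0
    · simp [hd j h0]
    · rw [hKd j h0, h.gradient_eq h0]; ring
  rw [dotProduct_sub, h1] at h2
  linarith

/-- Two path points at which the path moves in parallel directions have the same signs. -/
lemma pattern_eq_of_smul_eq (hK : K.PosDef) (hs : s ≤ 0) (ht : t ≤ 0)
    (h : IsPathPoint K b s β) (h' : IsPathPoint K b t γ) (hβ : β ≠ 0) (hγ : γ ≠ 0)
    {d d' : J → ℝ} {c : ℝ} (hc : d' = c • d)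
    (hd : ∀ j, β j = 0 → d j = 0) (hKd : ∀ j, β j ≠ 0 → (K *ᵥ d) j = SignType.sign (β j))
    (hd' : ∀ j, γ j = 0 → d' j = 0)
    (hKd' : ∀ j, γ j ≠ 0 → (K *ᵥ d') j = SignType.sign (γ j)) :
    pattern β = pattern γ := by
  have hsq : ∀ r : ℝ, r ≠ 0 → (SignType.sign r : ℝ) * SignType.sign r = 1 := fun r hr => by
    rcases lt_or_gt_of_ne hr with h | h <;> simp [sign_neg, sign_pos, h]
  have hd0 : d' ≠ 0 := by
    rintro rfl
    obtain ⟨j, hj⟩ := Function.ne_iff.1 hγ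
    have h1 := hKd' j hj
    have h2 := hsq _ hj
    rw [mulVec_zero, Pi.zero_apply] at h1
    simp [← h1] at h2
  obtain ⟨j, hj⟩ := Function.ne_iff.1 hd0
  have hjγ : γ j ≠ 0 := fun h0 => hj (hd' j h0)
  have hjβ : β j ≠ 0 := fun h0 => hj (by simp [hc, hd j h0])
  have e1 : (SignType.sign (γ j) : ℝ) = c * SignType.sign (β j) := by
    rw [← hKd j hjβ, ← hKd' j hjγ, hc, mulVec_smul]; rfl
  have hcc : c * c = 1 := by
    have h1 := hsq _ hjβ
    have h2 := hsq _ hjγ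
    rw [e1] at h2
    linear_combination h2 - c * c * h1
  rcases mul_self_eq_one_iff.1 hcc with rfl | rfl
  · rw [one_smul] at hc
    subst hc
    have hsame : ∀ j, β j ≠ 0 → γ j ≠ 0 →
        (SignType.sign (β j) : ℝ) = SignType.sign (γ j) := fun j h1 h2 => by
      rw [← hKd j h1, ← hKd' j h2]
    have hzero : (γ - t • d') - (β - s • d') = 0 := by
      refine PosDef_eq_zero hK (Finset.sum_nonpos fun j _ => ?_)
      have e : (K *ᵥ ((γ - t • d') - (β - s • d'))) j =
          ((K *ᵥ γ - b) j - t * (K *ᵥ d') j) - ((K *ᵥ β - b) j - s * (K *ᵥ d') j) := by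
        simp only [mulVec_sub, mulVec_smul, Pi.sub_apply, Pi.smul_apply, smul_eq_mul]
        ring
      rw [e]
      simp only [Pi.sub_apply (γ - t • d'), Pi.sub_apply γ, Pi.sub_apply β, Pi.smul_apply,
        smul_eq_mul]
      by_cases h1 : β j = 0 <;> by_cases h2 : γ j = 0
      · simp [h1, h2, hd j h1]
      · have h3 := h.abs_le j
        have h4 := neg_abs_le ((K *ᵥ β - b) j * γ j)
        rw [abs_mul] at h4
        rw [h'.gradient_eq h2, hKd' j h2, h1, hd j h1]
        have h5 := self_mul_sign (γ j)
        nlinarith [abs_nonneg (γ j)]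
      · have h3 := h'.abs_le j
        have h4 := neg_abs_le ((K *ᵥ γ - b) j * β j)
        rw [abs_mul] at h4
        rw [h.gradient_eq h1, hKd j h1, h2, hd' j h2]
        have h5 := self_mul_sign (β j)
        nlinarith [abs_nonneg (β j)]
      · rw [h.gradient_eq h1, h'.gradient_eq h2, hKd j h1, hsame j h1 h2]
        simp
    funext j
    have hj := congrFun hzero j
    simp only [Pi.sub_apply, Pi.smul_apply, smul_eq_mul, Pi.zero_apply] at hj
    simp only [pattern]
    by_cases h1 : β j = 0 <;> by_cases h2 : γ j = 0
    · rw [h1, h2]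
    · exact absurd (by simpa [hd j h1, h1] using hj) h2
    · exact absurd (by simpa [hd' j h2, h2] using hj) h1
    · have h3 := hsame j h1 h2
      rcases lt_or_gt_of_ne h1 with h4 | h4 <;> rcases lt_or_gt_of_ne h2 with h5 | h5 <;>
        simp only [h4, h5, sign_neg, sign_pos] at h3 ⊢ <;> norm_num at h3
  · exfalso
    have e2 := h.l1_eq hK hd hKd
    have e3 := h'.l1_eq hK hd' hKd'
    rw [hc, neg_one_smul, mulVec_neg, neg_dotProduct_neg, neg_dotProduct] at e3
    have h1 := PosDef_nonneg hK d
    have h2 : l1 β ≠ 0 := fun h0 => hβ (l1_eq_zero.1 h0)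
    have h3 := lt_of_le_of_ne (l1_nonneg β) h2.symm
    nlinarith [l1_nonneg γ]

end Pattern

/-! ### Intervals of constant signs and breakpoints -/

section Breakpoints

variable {J : Type*} [Fintype J] {K : Matrix J J ℝ} {b : J → ℝ} {s t : ℝ}

/-- The parameters at which the coordinates of the path have given signs. -/
def signSet (K : Matrix J J ℝ) (b : J → ℝ) (τ : J → SignType) : Set ℝ :=
  {s | s ∈ Set.Icc (-‖b‖) 0 ∧ pattern (path K b s) = τ}

/-- The parameters near which the signs of the coordinates of the path are not constant. -/
def breakpoints (K : Matrix J J ℝ) (b : J → ℝ) : Set ℝ :=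
  Set.Icc (-‖b‖) 0 \ ⋃ τ, interior (signSet K b τ)

lemma signSet_subset (τ : J → SignType) : signSet K b τ ⊆ Set.Icc (-‖b‖) 0 := fun _ h => h.1

lemma ordConnected_signSet [DecidableEq J] (hK : K.PosDef) (τ : J → SignType) :
    (signSet K b τ).OrdConnected := by
  refine Convex.ordConnected fun s hs t ht a c ha hc hac => ?_
  have hmem := convex_Icc (-‖b‖) 0 hs.1 ht.1 ha hc hac
  refine ⟨hmem, ?_⟩
  have hp := hs.2.trans ht.2.symm
  rw [((path_spec hK hs.1.2).add_smul (path_spec hK ht.1.2) ha hc hac hp).eq_path hK hmem.2,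
    pattern_add_smul ha hc hac hp, hs.2]

lemma eq_sInf_or_eq_sSup {S : Set ℝ} (hS : S.OrdConnected) (hb : BddBelow S) (ha : BddAbove S)
    (hs : s ∈ S) (hi : s ∉ interior S) : s = sInf S ∨ s = sSup S := by
  by_contra! hne
  obtain ⟨u, hu, hus⟩ := exists_lt_of_csInf_lt ⟨s, hs⟩ ((csInf_le hb hs).lt_of_ne' hne.1)
  obtain ⟨v, hv, hsv⟩ := exists_lt_of_lt_csSup ⟨s, hs⟩ ((le_csSup ha hs).lt_of_ne hne.2)
  exact hi (mem_interior.2 ⟨Set.Ioo u v, Set.Ioo_subset_Icc_self.trans (hS.out hu hv),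
    isOpen_Ioo, hus, hsv⟩)

lemma finite_breakpoints [DecidableEq J] (hK : K.PosDef) : (breakpoints K b).Finite := by
  refine Set.Finite.subset ((Set.finite_range fun τ => sInf (signSet K b τ)).union
    (Set.finite_range fun τ => sSup (signSet K b τ))) fun s hs => ?_
  have hi : s ∉ interior (signSet K b (pattern (path K b s))) := fun h =>
    hs.2 (Set.mem_iUnion.2 ⟨_, h⟩)
  rcases eq_sInf_or_eq_sSup (ordConnected_signSet hK _) (bddBelow_Icc.mono (signSet_subset _))
    (bddAbove_Icc.mono (signSet_subset _)) ⟨hs.1, rfl⟩ hi with h | h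
  · exact Or.inl ⟨_, h.symm⟩
  · exact Or.inr ⟨_, h.symm⟩

lemma interior_signSet_subset (τ : J → SignType) :
    interior (signSet K b τ) ⊆ Set.Ioo (-‖b‖) 0 := by
  rw [← interior_Icc]
  exact interior_mono (signSet_subset τ)

lemma neg_norm_mem_breakpoints : -‖b‖ ∈ breakpoints K b :=
  ⟨⟨le_rfl, by simp⟩, fun h => by
    obtain ⟨τ, h⟩ := Set.mem_iUnion.1 h
    exact (interior_signSet_subset τ h).1.ne rfl⟩

lemma zero_mem_breakpoints : 0 ∈ breakpoints K b :=
  ⟨⟨by simp, le_rfl⟩, fun h => by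
    obtain ⟨τ, h⟩ := Set.mem_iUnion.1 h
    exact (interior_signSet_subset τ h).2.ne rfl⟩

lemma exists_Ioo_subset_signSet (hst : s < t) (hs : -‖b‖ ≤ s) (ht : t ≤ 0)
    (hd : Disjoint (Set.Ioo s t) (breakpoints K b)) :
    ∃ τ, Set.Ioo s t ⊆ signSet K b τ := by
  have hsub : Set.Ioo s t ⊆ Set.Icc (-‖b‖) 0 := fun r hr =>
    ⟨hs.trans hr.1.le, hr.2.le.trans ht⟩
  have hcont : ContinuousOn (fun r => pattern (path K b r)) (Set.Ioo s t) := fun r hr => by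
    have h1 : r ∈ ⋃ τ, interior (signSet K b τ) := by
      by_contra hc
      exact Set.disjoint_left.1 hd hr ⟨hsub hr, hc⟩
    obtain ⟨τ, hτ⟩ := Set.mem_iUnion.1 h1
    refine ContinuousAt.continuousWithinAt (continuousAt_const.congr (f := fun _ => τ) ?_)
    filter_upwards [mem_interior_iff_mem_nhds.1 hτ] with u hu using hu.2.symm
  obtain ⟨r, hr⟩ := Set.nonempty_Ioo.2 hst
  exact ⟨_, fun u hu => ⟨hsub hu, isPreconnected_Ioo.constant hcont hu hr⟩⟩

/-- Different intervals between breakpoints belong to different signs. -/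
lemma pattern_ne_of_breakpoint [DecidableEq J] (hK : K.PosDef) {r : ℝ}
    (hr : r ∈ breakpoints K b) (hs : s ∈ Set.Icc (-‖b‖) 0) (ht : t ∈ Set.Icc (-‖b‖) 0)
    (hsr : s < r) (hrt : r < t) : pattern (path K b s) ≠ pattern (path K b t) := fun h =>
  hr.2 (Set.mem_iUnion.2 ⟨_, mem_interior.2 ⟨Set.Ioo s t, Set.Ioo_subset_Icc_self.trans
    ((ordConnected_signSet hK _).out ⟨hs, h⟩ ⟨ht, rfl⟩), isOpen_Ioo, hsr, hrt⟩⟩)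

end Breakpoints

/-! ### The path on an interval of constant signs -/

section Face

variable {J : Type*} {K : Matrix J J ℝ} {b β : J → ℝ} {s t : ℝ}

/-- The covariance matrix of a coordinate face. -/
def faceMatrix (K : Matrix J J ℝ) (A : Finset J) : Matrix A A ℝ :=
  K.submatrix Subtype.val Subtype.val

section

variable [Fintype J]

/-- The support of a sign vector. -/
def face (τ : J → SignType) : Finset J := Finset.univ.filter fun j => τ j ≠ 0

lemma mem_face {τ : J → SignType} {j : J} : j ∈ face τ ↔ τ j ≠ 0 := by simp [face]

/-- The signs on the support of a sign vector. -/
def faceSign (τ : J → SignType) : face τ → ℝ := fun j => (τ j : ℝ)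

lemma faceSign_eq (τ : J → SignType) (j : face τ) : faceSign τ j = 1 ∨ faceSign τ j = -1 := by
  have h := mem_face.1 j.2
  rcases hj : τ j with _ | _ | _
  · exact absurd hj h
  · right; simp [faceSign, hj]
  · left; simp [faceSign, hj]

end

variable [DecidableEq J]

/-- The point with parameter `s` on the ray of a coordinate face. -/
def facePoint (K : Matrix J J ℝ) (b : J → ℝ) (A : Finset J) (δ : A → ℝ) (s : ℝ) : J → ℝ :=
  extendZero A ((faceMatrix K A)⁻¹ *ᵥ (fun j => b j) + s • (faceMatrix K A)⁻¹ *ᵥ δ)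

lemma extendZero_add_smul (A : Finset J) (u w : A → ℝ) (s : ℝ) :
    extendZero A (u + s • w) = extendZero A u + s • extendZero A w := by
  funext j
  by_cases h : j ∈ A <;> simp [extendZero, h]

lemma facePoint_eq (A : Finset J) (δ : A → ℝ) (s : ℝ) :
    facePoint K b A δ s = extendZero A ((faceMatrix K A)⁻¹ *ᵥ fun j => b j) +
      s • extendZero A ((faceMatrix K A)⁻¹ *ᵥ δ) := extendZero_add_smul A _ _ s

lemma isUnit_det_faceMatrix (hK : K.PosDef) (A : Finset J) : IsUnit (faceMatrix K A).det :=
  (isUnit_iff_isUnit_det _).1 (hK.submatrix Subtype.val_injective).isUnit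

variable [Fintype J]

lemma mulVec_extendZero (A : Finset J) (u : A → ℝ) (j : A) :
    (K *ᵥ extendZero A u) j = (faceMatrix K A *ᵥ u) j := by
  simp only [mulVec, dotProduct]
  rw [← Finset.sum_subset (Finset.subset_univ A) fun l _ hl => by simp [extendZero, hl],
    ← Finset.sum_coe_sort]
  exact Finset.sum_congr rfl fun l _ => by simp [extendZero, faceMatrix]

lemma mulVec_extendZero_inv (hK : K.PosDef) (A : Finset J) (δ : A → ℝ) (j : A) :
    (K *ᵥ extendZero A ((faceMatrix K A)⁻¹ *ᵥ δ)) j = δ j := by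
  rw [mulVec_extendZero, mulVec_mulVec, mul_nonsing_inv _ (isUnit_det_faceMatrix hK A),
    one_mulVec]

lemma IsPathPoint.eq_facePoint (hK : K.PosDef) (h : IsPathPoint K b s β) {τ : J → SignType}
    (hτ : pattern β = τ) : β = facePoint K b (face τ) (faceSign τ) s := by
  have hext : extendZero (face τ) (fun j => β j) = β := by
    funext j
    by_cases hj : j ∈ face τ
    · simp [extendZero, hj]
    · have : β j = 0 := by
        rw [← pattern_apply_eq_zero, hτ]
        simpa [mem_face] using hj
      simp [extendZero, hj, this]
  have hlin : faceMatrix K (face τ) *ᵥ (fun j : face τ => β j) = (fun j : face τ => b j) + s • faceSign τ := by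
    funext j
    have hj : β j ≠ 0 := fun h0 => mem_face.1 j.2 ((congrFun hτ j).symm.trans
      (pattern_apply_eq_zero.2 h0))
    have h1 := h.gradient_eq hj
    have h2 : SignType.sign (β j) = τ j := congrFun hτ j
    rw [← mulVec_extendZero, hext]
    rw [h2, Pi.sub_apply] at h1
    simp only [Pi.add_apply, Pi.smul_apply, smul_eq_mul, faceSign]
    linarith
  rw [facePoint, ← mulVec_smul, ← mulVec_add, ← hlin, mulVec_mulVec,
    nonsing_inv_mul _ (isUnit_det_faceMatrix hK _), one_mulVec, hext]

lemma path_eq_facePoint (hK : K.PosDef) {τ : J → SignType} (hst : s < t) (ht : t ≤ 0)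
    (h : Set.Ioo s t ⊆ signSet K b τ) :
    Set.EqOn (path K b) (facePoint K b (face τ) (faceSign τ)) (Set.Icc s t) := by
  have h1 : Set.EqOn (path K b) (facePoint K b (face τ) (faceSign τ)) (Set.Ioo s t) :=
    fun r hr => (path_spec hK (h hr).1.2).eq_facePoint hK (h hr).2
  refine h1.of_subset_closure ((continuousOn_path hK).mono fun r hr => hr.2.trans ht) ?_
    Set.Ioo_subset_Icc_self (closure_Ioo hst.ne).ge
  refine Continuous.continuousOn ?_
  simp only [funext (facePoint_eq (K := K) (b := b) (face τ) (faceSign τ))]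
  fun_prop

end Face

/-! ### Least squares as a quadratic problem -/

section Data

variable {N : ℕ} {J : Type*} {x : Fin N → J → ℝ} {y : Fin N → ℝ}

/-- The predictors relative to their centroid. -/
def centered (x : Fin N → J → ℝ) : Matrix (Fin N) J ℝ :=
  fun i j => x i j - mean fun k => x k j

lemma covMatrix_eq (x : Fin N → J → ℝ) :
    covMatrix x = (N : ℝ)⁻¹ • ((centered x)ᵀ * centered x) := by
  ext j l
  simp [covMatrix, mean, centered, mul_apply, div_eq_inv_mul]

lemma covVector_eq (x : Fin N → J → ℝ) (y : Fin N → ℝ) :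
    covVector x y = (N : ℝ)⁻¹ • ((centered x)ᵀ *ᵥ fun i => y i - mean y) := by
  ext j
  simp [covVector, mean, centered, mulVec, dotProduct, div_eq_inv_mul]

lemma FullRank.pos (hx : FullRank x) : 0 < N := by
  rcases Nat.eq_zero_or_pos N with rfl | h
  · rw [FullRank, Set.range_eq_empty, AffineSubspace.span_empty] at hx
    exact absurd hx (AffineSubspace.bot_ne_top ℝ _ _)
  · exact h

lemma sum_sub_mean (hN : 0 < N) (z : Fin N → ℝ) : ∑ i, (z i - mean z) = 0 := by
  have : (N : ℝ) ≠ 0 := by positivity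
  simp [mean]
  field_simp
  ring

variable [Fintype J]

lemma dotProduct_covMatrix_mulVec (x : Fin N → J → ℝ) (v : J → ℝ) :
    v ⬝ᵥ covMatrix x *ᵥ v = (N : ℝ)⁻¹ * ∑ i, (centered x *ᵥ v) i ^ 2 := by
  rw [covMatrix_eq, smul_mulVec, dotProduct_smul, ← mulVec_mulVec, dotProduct_mulVec,
    vecMul_transpose]
  simp [dotProduct, sq]

lemma covVector_dotProduct (x : Fin N → J → ℝ) (y : Fin N → ℝ) (v : J → ℝ) :
    covVector x y ⬝ᵥ v = (N : ℝ)⁻¹ * ∑ i, (y i - mean y) * (centered x *ᵥ v) i := by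
  rw [covVector_eq, smul_dotProduct, dotProduct_comm, dotProduct_mulVec, vecMul_transpose]
  simp [dotProduct, mul_comm]

lemma centered_mulVec (x : Fin N → J → ℝ) (v : J → ℝ) (i : Fin N) :
    (centered x *ᵥ v) i = ∑ j, v j * x i j - ∑ j, v j * mean fun k => x k j := by
  simp only [mulVec, dotProduct, centered, ← Finset.sum_sub_distrib]
  exact Finset.sum_congr rfl fun j _ => by ring

lemma sum_centered_mulVec (hN : 0 < N) (x : Fin N → J → ℝ) (v : J → ℝ) :
    ∑ i, (centered x *ᵥ v) i = 0 := by
  simp only [mulVec, dotProduct, centered]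
  rw [Finset.sum_comm]
  refine Finset.sum_eq_zero fun j _ => ?_
  rw [← Finset.sum_mul, sum_sub_mean hN fun k => x k j, zero_mul]

lemma FullRank.posDef (hx : FullRank x) : (covMatrix x).PosDef := by
  have hN := hx.pos
  refine PosDef.of_dotProduct_mulVec_pos ?_ fun v hv => ?_
  · rw [covMatrix_eq, IsHermitian, conjTranspose_smul, conjTranspose_mul]
    simp
  · have h0 : 0 ≤ (N : ℝ)⁻¹ * ∑ i, (centered x *ᵥ v) i ^ 2 := by positivity
    rw [star_trivial, dotProduct_covMatrix_mulVec]
    refine lt_of_le_of_ne h0 fun h => hv ?_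
    have h1 : ∑ i, (centered x *ᵥ v) i ^ 2 = 0 := by
      rcases mul_eq_zero.1 h.symm with h2 | h2
      · exact absurd h2 (by positivity)
      · exact h2
    rw [Finset.sum_eq_zero_iff_of_nonneg fun _ _ => sq_nonneg _] at h1
    let L : (J → ℝ) →ₗ[ℝ] ℝ := Fintype.linearCombination ℝ v
    have hL : ∀ z, L z = ∑ j, v j * z j := fun z => by
      simp [L, Fintype.linearCombination_apply, mul_comm]
    let c : J → ℝ := fun j => mean fun k => x k j
    have hsub : affineSpan ℝ (Set.range x) ≤ AffineSubspace.mk' c (LinearMap.ker L) := by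
      rw [affineSpan_le]
      rintro _ ⟨i, rfl⟩
      rw [SetLike.mem_coe, AffineSubspace.mem_mk', vsub_eq_sub, LinearMap.mem_ker, map_sub, hL,
        hL, ← centered_mulVec]
      exact pow_eq_zero_iff two_ne_zero |>.1 (h1 i (Finset.mem_univ i))
    rw [hx] at hsub
    have h2 : c + v ∈ AffineSubspace.mk' c (LinearMap.ker L) := hsub (AffineSubspace.mem_top ..)
    rw [AffineSubspace.mem_mk', vsub_eq_sub, add_sub_cancel_left, LinearMap.mem_ker, hL] at h2
    exact dotProduct_self_eq_zero.1 h2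

/-- The least square objective function splits into a constant, a function of the slopes, and
the square of the deviation of the intercept from its best value. -/
lemma objective_eq (hN : 0 < N) (x : Fin N → J → ℝ) (y : Fin N → ℝ) (β₀ : ℝ) (β : J → ℝ) :
    objective x y β₀ β = 1 / 2 * ∑ i, (y i - mean y) ^ 2 +
      N * quad (covMatrix x) (covVector x y) β +
      N / 2 * (β₀ - mean y + ∑ j, β j * mean fun k => x k j) ^ 2 := by
  have hN' : (N : ℝ) ≠ 0 := by positivity
  set r := β₀ - mean y + ∑ j, β j * mean fun k => x k j with hr
  have e : ∀ i, (y i - β₀ - ∑ j, β j * x i j) ^ 2 = (y i - mean y) ^ 2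
      - 2 * ((y i - mean y) * (centered x *ᵥ β) i) + (centered x *ᵥ β) i ^ 2
      - 2 * r * (y i - mean y) + 2 * r * (centered x *ᵥ β) i + r ^ 2 := fun i => by
    rw [centered_mulVec, hr]; ring
  rw [objective, quad, dotProduct_covMatrix_mulVec, covVector_dotProduct]
  simp only [e, Finset.sum_add_distrib, Finset.sum_sub_distrib (f := fun i => _ + _),
    Finset.sum_sub_distrib (f := fun i => (y i - mean y) ^ 2), ← Finset.mul_sum,
    sum_sub_mean hN, sum_centered_mulVec hN]
  simp
  field_simp
  ring

lemma objective_min_iff (hN : 0 < N) (x : Fin N → J → ℝ) (y : Fin N → ℝ) (β : J → ℝ)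
    (P : (J → ℝ) → Prop) :
    (∃ β₀, ∀ γ₀ γ, P γ → objective x y β₀ β ≤ objective x y γ₀ γ) ↔
      ∀ γ, P γ → quad (covMatrix x) (covVector x y) β ≤ quad (covMatrix x) (covVector x y) γ := by
  have hN' : (0 : ℝ) < N := by positivity
  simp only [objective_eq hN]
  constructor
  · rintro ⟨β₀, h⟩ γ hγ
    have h1 := h (mean y - ∑ j, γ j * mean fun k => x k j) γ hγ
    rw [sub_sub_cancel_left, neg_add_cancel] at h1
    have h2 := sq_nonneg (β₀ - mean y + ∑ j, β j * mean fun k => x k j)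
    refine le_of_mul_le_mul_left ?_ hN'
    nlinarith
  · intro h
    refine ⟨mean y - ∑ j, β j * mean fun k => x k j, fun γ₀ γ hγ => ?_⟩
    rw [sub_sub_cancel_left, neg_add_cancel]
    have h1 := mul_le_mul_of_nonneg_left (h γ hγ) hN'.le
    have h2 := sq_nonneg (γ₀ - mean y + ∑ j, γ j * mean fun k => x k j)
    nlinarith

lemma isLassoSolution_iff [DecidableEq J] (hN : 0 < N) {t : ℝ} {β : J → ℝ} :
    IsLassoSolution x y t β ↔ l1 β ≤ t ∧ ∀ γ, l1 γ ≤ t →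
      quad (covMatrix x) (covVector x y) β ≤ quad (covMatrix x) (covVector x y) γ := by
  rw [IsLassoSolution, objective_min_iff hN]

lemma isLeastSquares_iff (hN : 0 < N) {β : J → ℝ} :
    IsLeastSquares x y β ↔ ∀ γ,
      quad (covMatrix x) (covVector x y) β ≤ quad (covMatrix x) (covVector x y) γ := by
  have := objective_min_iff hN x y β fun _ => True
  simpa [IsLeastSquares] using this

lemma quad_center_add [DecidableEq J] (hx : FullRank x) (y : Fin N → ℝ) (γ : J → ℝ) :
    quad (covMatrix x) (covVector x y) (center x y) +
      1 / 2 * ((γ - center x y) ⬝ᵥ covMatrix x *ᵥ (γ - center x y)) =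
      quad (covMatrix x) (covVector x y) γ := by
  have h := quad_sub hx.posDef (covVector x y) (center x y) γ
  have hc : covMatrix x *ᵥ center x y = covVector x y := by
    rw [center, mulVec_mulVec,
      mul_nonsing_inv _ ((isUnit_iff_isUnit_det _).1 hx.posDef.isUnit), one_mulVec]
  rw [hc, sub_self, zero_dotProduct] at h
  linarith

theorem isLeastSquares_iff_eq_center [DecidableEq J] (hx : FullRank x) {γ : J → ℝ} :
    IsLeastSquares x y γ ↔ γ = center x y := by
  rw [isLeastSquares_iff hx.pos]
  constructor
  · intro h
    have h1 := h (center x y)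
    have h2 := quad_center_add hx y γ
    exact sub_eq_zero.1 (PosDef_eq_zero hx.posDef (by linarith))
  · rintro rfl γ
    have h1 := PosDef_nonneg hx.posDef (γ - center x y)
    have h2 := quad_center_add hx y γ
    linarith

/-- The lasso path of a data set. -/
abbrev lassoPath (x : Fin N → J → ℝ) (y : Fin N → ℝ) : ℝ → J → ℝ :=
  path (covMatrix x) (covVector x y)

theorem isLassoSolution_iff_eq_lassoPath [DecidableEq J] (hx : FullRank x) {s : ℝ} (hs : s ≤ 0)
    {γ : J → ℝ} :
    IsLassoSolution x y (l1 (lassoPath x y s)) γ ↔ γ = lassoPath x y s := by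
  have hp := path_spec (b := covVector x y) hx.posDef hs
  rw [isLassoSolution_iff hx.pos]
  constructor
  · rintro ⟨h1, h2⟩
    have h3 := hp.quad_add_le hx.posDef hs h1
    have h4 := h2 _ le_rfl
    exact sub_eq_zero.1 (PosDef_eq_zero hx.posDef (by linarith))
  · rintro rfl
    refine ⟨le_rfl, fun γ hγ => ?_⟩
    have h3 := hp.quad_add_le hx.posDef hs hγ
    have h4 := PosDef_nonneg hx.posDef (γ - lassoPath x y s)
    linarith

lemma IsLassoSolution.eq_center [DecidableEq J] (hx : FullRank x) {t : ℝ} {γ : J → ℝ}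
    (ht : l1 (center x y) ≤ t) (h : IsLassoSolution x y t γ) : γ = center x y := by
  have h1 := ((isLassoSolution_iff hx.pos).1 h).2 _ ht
  have h2 := quad_center_add hx y γ
  exact sub_eq_zero.1 (PosDef_eq_zero hx.posDef (by linarith))

/-- Every lasso solution lies on the lasso path. -/
lemma IsLassoSolution.exists_eq_lassoPath [DecidableEq J] (hx : FullRank x) {t : ℝ} {γ : J → ℝ}
    (h : IsLassoSolution x y t γ) :
    ∃ s ∈ Set.Icc (-‖covVector x y‖) 0, γ = lassoPath x y s ∧ l1 γ = min t (l1 (center x y)) := by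
  rcases le_total t (l1 (center x y)) with ht | ht
  · have h0 : t ∈ Set.Icc 0 (l1 (center x y)) := ⟨(l1_nonneg γ).trans h.1, ht⟩
    rw [center, ← image_l1_path hx.posDef] at h0
    obtain ⟨s, hs, rfl⟩ := h0
    have h1 := (isLassoSolution_iff_eq_lassoPath hx hs.2).1 h
    exact ⟨s, hs, h1, by rw [min_eq_left ht, h1]⟩
  · refine ⟨0, ⟨by simp, le_rfl⟩, ?_, ?_⟩
    · rw [lassoPath, path_zero hx.posDef]
      exact h.eq_center hx ht
    · rw [min_eq_right ht, h.eq_center hx ht]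

theorem isLassoSolutionAt_iff_eq_lassoPath [DecidableEq J] (hx : FullRank x) {s : ℝ}
    (hs : s ∈ Set.Ioc (-‖covVector x y‖) 0) {γ : J → ℝ} :
    IsLassoSolutionAt x y s γ ↔ γ = lassoPath x y s := by
  have hK := hx.posDef
  have hp := path_spec (b := covVector x y) hK hs.2
  have hp0 := path_ne_zero hK hs
  have hsign : ∀ r : ℝ, Real.sign r = (SignType.sign r : ℝ) := fun r => by
    rcases lt_trichotomy r 0 with h | h | h
    · simp [Real.sign_of_neg, sign_neg, h]
    · simp [h]
    · simp [Real.sign_of_pos, sign_pos, h]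
  constructor
  · rintro ⟨⟨t, ht, h⟩, hg⟩
    obtain ⟨r, hr, hγ, hl⟩ := h.exists_eq_lassoPath hx
    have hc0 : center x y ≠ 0 := fun h0 => by
      rw [center, ← path_zero hK, ← path_neg_norm (b := covVector x y) hK] at h0
      have := injOn_path hK ⟨by simp, le_rfl⟩ ⟨le_rfl, by simp⟩ h0
      linarith [hs.1, hs.2]
    have hγ0 : γ ≠ 0 := fun h0 => by
      rw [h0, l1_zero] at hl
      have h1 : 0 < l1 (center x y) :=
        lt_of_le_of_ne (l1_nonneg _) fun h2 => hc0 (l1_eq_zero.1 h2.symm)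
      exact absurd hl (lt_min ht h1).ne
    obtain ⟨j, hj⟩ := Function.ne_iff.1 hγ0
    have h1 := hg j hj
    have h2 : IsPathPoint (covMatrix x) (covVector x y) r γ := hγ ▸ path_spec hK hr.2
    rw [hsign, h2.gradient_eq hj] at h1
    have h3 : r = s := by
      refine mul_right_cancel₀ ?_ h1
      rcases lt_or_gt_of_ne hj with h | h <;> simp only [Pi.zero_apply] at h <;>
        simp [h]
    rw [hγ, h3]
  · rintro rfl
    refine ⟨⟨l1 (lassoPath x y s), ?_, (isLassoSolution_iff_eq_lassoPath hx hs.2).2 rfl⟩, ?_⟩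
    · exact lt_of_le_of_ne (l1_nonneg _) fun h => hp0 (l1_eq_zero.1 h.symm)
    · intro j hj
      rw [hsign]
      exact hp.gradient_eq hj

end Data

end Lasso

/-! ### Polygonal chains from piecewise affine paths -/

namespace PolygonalChain

variable {E : Type*} [AddCommGroup E] [Module ℝ E] {m : ℕ}

lemma exists_strictAnti_range_eq {B : Set ℝ} (hB : B.Finite) {a c : ℝ} (ha : a ∈ B) (hc : c ∈ B)
    (hac : B ⊆ Set.Icc a c) :
    ∃ (m : ℕ) (σ : Fin (m + 1) → ℝ), StrictAnti σ ∧ Set.range σ = B ∧ σ 0 = c ∧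
      σ (Fin.last m) = a := by
  obtain ⟨m, hm⟩ : ∃ m, hB.toFinset.card = m + 1 :=
    Nat.exists_eq_succ_of_ne_zero (Finset.card_ne_zero_of_mem (hB.mem_toFinset.2 ha))
  let σ : Fin (m + 1) → ℝ := hB.toFinset.orderEmbOfFin hm ∘ Fin.rev
  have hσ : StrictAnti σ := (OrderEmbedding.strictMono _).comp_strictAnti Fin.rev_strictAnti
  have hr : Set.range σ = B := by
    rw [Set.range_comp, Fin.rev_surjective.range_eq, Set.image_univ, Finset.range_orderEmbOfFin,
      hB.coe_toFinset]
  refine ⟨m, σ, hσ, hr, le_antisymm ?_ ?_, le_antisymm ?_ ?_⟩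
  · exact (hac (hr ▸ Set.mem_range_self 0)).2
  · obtain ⟨k, rfl⟩ := hr ▸ hc
    exact hσ.antitone (Fin.zero_le k)
  · obtain ⟨k, rfl⟩ := hr ▸ ha
    exact hσ.antitone (Fin.le_last k)
  · exact (hac (hr ▸ Set.mem_range_self _)).1

lemma disjoint_Ioo_range {σ : Fin (m + 1) → ℝ} (hσ : StrictAnti σ) (i : Fin m) :
    Disjoint (Set.Ioo (σ i.succ) (σ i.castSucc)) (Set.range σ) := by
  rw [Set.disjoint_left]
  rintro _ ⟨h1, h2⟩ ⟨k, rfl⟩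
  have h3 := hσ.lt_iff_gt.1 h1
  have h4 := hσ.lt_iff_gt.1 h2
  simp only [Fin.lt_def, Fin.val_succ, Fin.val_castSucc] at h3 h4
  omega

lemma mem_range_or_exists_mem_Icc (σ : Fin (m + 1) → ℝ) {s : ℝ}
    (hs : s ∈ Set.Icc (σ (Fin.last m)) (σ 0)) :
    s ∈ Set.range σ ∨ ∃ i : Fin m, s ∈ Set.Icc (σ i.succ) (σ i.castSucc) := by
  have key : ∀ k : Fin (m + 1), σ k ≤ s →
      s ∈ Set.range σ ∨ ∃ i : Fin m, s ∈ Set.Icc (σ i.succ) (σ i.castSucc) := by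
    intro k
    induction k using Fin.induction with
    | zero => exact fun h => Or.inl ⟨0, le_antisymm h hs.2⟩
    | succ i ih =>
      intro h
      rcases le_total (σ i.castSucc) s with h1 | h1
      · exact ih h1
      · exact Or.inr ⟨i, h, h1⟩
  exact key _ hs.1

variable {σ : Fin (m + 1) → ℝ} {f : ℝ → E} {e d : Fin m → E}

lemma edge_eq_image (hσ : StrictAnti σ)
    (hf : ∀ i, ∀ s ∈ Set.Icc (σ i.succ) (σ i.castSucc), f s = e i + s • d i) (i : Fin m) :
    edge (f ∘ σ) i = f '' Set.Icc (σ i.succ) (σ i.castSucc) := by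
  have hlt : σ i.succ < σ i.castSucc := hσ i.castSucc_lt_succ
  let g : ℝ →ᵃ[ℝ] E := AffineMap.lineMap (e i) (e i + d i)
  have hg : ∀ s, g s = e i + s • d i := fun s => by
    simp [g, AffineMap.lineMap_apply, add_comm]
  have hfg : Set.EqOn f g (Set.Icc (σ i.succ) (σ i.castSucc)) := fun s hs => by
    rw [hf i s hs, hg]
  rw [hfg.image_eq, ← segment_eq_Icc hlt.le, segment_symm, image_segment, edge,
    Function.comp_apply, Function.comp_apply, hfg ⟨hlt.le, le_rfl⟩, hfg ⟨le_rfl, hlt.le⟩]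

lemma Icc_subset_Icc_of_strictAnti (hσ : StrictAnti σ) (i : Fin m) :
    Set.Icc (σ i.succ) (σ i.castSucc) ⊆ Set.Icc (σ (Fin.last m)) (σ 0) :=
  Set.Icc_subset_Icc (hσ.antitone (Fin.le_last _)) (hσ.antitone (Fin.zero_le _))

lemma isSimple_of_injOn (hσ : StrictAnti σ)
    (hinj : Set.InjOn f (Set.Icc (σ (Fin.last m)) (σ 0)))
    (hf : ∀ i, ∀ s ∈ Set.Icc (σ i.succ) (σ i.castSucc), f s = e i + s • d i) :
    IsSimple (f ∘ σ) := by
  have hsub := fun i : Fin m => Icc_subset_Icc_of_strictAnti hσ i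
  have hlt : ∀ i : Fin m, σ i.succ < σ i.castSucc := fun i => hσ i.castSucc_lt_succ
  refine ⟨fun i h => ?_, fun i j hij => ?_, fun i j hij => ?_⟩
  · exact (hlt i).ne' (hinj (hsub i ⟨(hlt i).le, le_rfl⟩) (hsub i ⟨le_rfl, (hlt i).le⟩) h)
  · have hji : j.castSucc = i.succ := by ext; simpa using hij
    have h2 := hlt j
    rw [edge_eq_image hσ hf, edge_eq_image hσ hf, ← hinj.image_inter (hsub i) (hsub j)]
    rw [hji] at h2 ⊢
    rw [Set.inter_comm, Set.Icc_inter_Icc_eq_singleton h2.le (hlt i).le, Set.image_singleton,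
      Function.comp_apply]
  · have hji : σ j.castSucc < σ i.succ := hσ (by simpa [Fin.lt_def] using hij)
    rw [edge_eq_image hσ hf, edge_eq_image hσ hf, Set.disjoint_iff_inter_eq_empty,
      ← hinj.image_inter (hsub i) (hsub j), Set.image_eq_empty]
    ext s
    simp only [Set.mem_inter_iff, Set.mem_Icc, Set.mem_empty_iff_false, iff_false]
    rintro ⟨h1, h2⟩
    linarith [h1.1, h2.2]

lemma image_Icc_eq_trace (hσ : StrictAnti σ)
    (hf : ∀ i, ∀ s ∈ Set.Icc (σ i.succ) (σ i.castSucc), f s = e i + s • d i) :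
    f '' Set.Icc (σ (Fin.last m)) (σ 0) = trace (f ∘ σ) := by
  simp only [trace, edge_eq_image hσ hf]
  apply Set.Subset.antisymm
  · rintro _ ⟨s, hs, rfl⟩
    rcases mem_range_or_exists_mem_Icc σ hs with ⟨k, rfl⟩ | ⟨i, hi⟩
    · exact Or.inl ⟨k, rfl⟩
    · exact Or.inr (Set.mem_iUnion.2 ⟨i, Set.mem_image_of_mem f hi⟩)
  · rintro _ (⟨k, rfl⟩ | h)
    · exact Set.mem_image_of_mem f ⟨hσ.antitone (Fin.le_last _), hσ.antitone (Fin.zero_le _)⟩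
    · obtain ⟨i, hi⟩ := Set.mem_iUnion.1 h
      exact Set.image_mono (Icc_subset_Icc_of_strictAnti hσ i) hi

lemma exists_smul_eq_of_parallel (hσ : StrictAnti σ)
    (hf : ∀ i, ∀ s ∈ Set.Icc (σ i.succ) (σ i.castSucc), f s = e i + s • d i) {i j : Fin m}
    (h : (affineSpan ℝ {(f ∘ σ) i.castSucc, (f ∘ σ) i.succ}).Parallel
      (affineSpan ℝ {(f ∘ σ) j.castSucc, (f ∘ σ) j.succ})) : ∃ c : ℝ, d j = c • d i := by
  have hlt : ∀ i : Fin m, σ i.succ < σ i.castSucc := fun i => hσ i.castSucc_lt_succ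
  have hsub : ∀ i, (f ∘ σ) i.castSucc - (f ∘ σ) i.succ = (σ i.castSucc - σ i.succ) • d i :=
    fun i => by
      rw [Function.comp_apply, Function.comp_apply, hf i _ ⟨(hlt i).le, le_rfl⟩,
        hf i _ ⟨le_rfl, (hlt i).le⟩]
      module
  have h1 := h.direction_eq
  rw [direction_affineSpan, direction_affineSpan] at h1
  have h2 : (f ∘ σ) j.castSucc -ᵥ (f ∘ σ) j.succ ∈
      vectorSpan ℝ {(f ∘ σ) i.castSucc, (f ∘ σ) i.succ} := by
    rw [h1, mem_vectorSpan_pair]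
    exact ⟨1, one_smul _ _⟩
  obtain ⟨r, hr⟩ := mem_vectorSpan_pair.1 h2
  rw [vsub_eq_sub, vsub_eq_sub, hsub, hsub] at hr
  refine ⟨(σ j.castSucc - σ j.succ)⁻¹ * (r * (σ i.castSucc - σ i.succ)), ?_⟩
  rw [mul_smul, mul_smul, hr, inv_smul_smul₀ (sub_pos.2 (hlt j)).ne']

end PolygonalChain

end

theorem mainTheorem1 {N p : ℕ} (x : Fin N → Fin p → ℝ) (y : Fin N → ℝ)
    (hx : Lasso.FullRank x) :
    (∀ γ : Fin p → ℝ, Lasso.IsLeastSquares x y γ ↔ γ = Lasso.center x y) ∧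
    ∃ (s' : ℝ) (β : ℝ → Fin p → ℝ),
      -- `β s` is the unique lasso solution with parameter `s`
      (∀ s ∈ Set.Ioc s' 0, ∀ γ : Fin p → ℝ, Lasso.IsLassoSolutionAt x y s γ ↔ γ = β s) ∧
      -- equivalently, with `t = ‖β s‖₁`, it is the unique lasso solution with constraint `t`
      StrictMonoOn (fun s => Lasso.l1 (β s)) (Set.Icc s' 0) ∧
      (fun s => Lasso.l1 (β s)) '' Set.Icc s' 0 = Set.Icc 0 (Lasso.l1 (Lasso.center x y)) ∧
      (∀ s ∈ Set.Icc s' 0, ∀ γ : Fin p → ℝ,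
        Lasso.IsLassoSolution x y (Lasso.l1 (β s)) γ ↔ γ = β s) ∧
      -- the path is a simple polygonal chain from the center to the origin
      ∃ (m : ℕ) (σ : Fin (m + 1) → ℝ) (v : Fin (m + 1) → Fin p → ℝ),
        StrictAnti σ ∧ σ 0 = 0 ∧ σ (Fin.last m) = s' ∧
        (∀ i, v i = β (σ i)) ∧
        v 0 = Lasso.center x y ∧ v (Fin.last m) = 0 ∧
        PolygonalChain.IsSimple v ∧
        β '' Set.Icc s' 0 = PolygonalChain.trace v ∧
        PolygonalChain.NoParallel v ∧
        -- every segment lies on a ray of the original problem or of an induced problem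
        ∀ i : Fin m, ∃ (A : Finset (Fin p)) (δ : A → ℝ),
          A.Nonempty ∧ (∀ j, δ j = 1 ∨ δ j = -1) ∧
          PolygonalChain.edge v i ⊆
            Lasso.extendZero A '' Lasso.ray (Lasso.induced x A) y δ ∧
          (∀ s ∈ Set.Icc (σ i.succ) (σ i.castSucc),
            β s = Lasso.extendZero A (Lasso.rayPoint (Lasso.induced x A) y δ s)) ∧
          (∀ s ∈ Set.Ioo (σ i.succ) (σ i.castSucc), ∀ j : A, 0 < δ j * β s j) := by
  classical
  have hK := hx.posDef
  set b := Lasso.covVector x y with hb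
  set β := Lasso.lassoPath x y with hβ
  obtain ⟨m, σ, hσ, hr, hσ0, hσm⟩ := PolygonalChain.exists_strictAnti_range_eq
    (Lasso.finite_breakpoints (b := b) hK) Lasso.neg_norm_mem_breakpoints
    Lasso.zero_mem_breakpoints Set.sdiff_subset
  have hlt : ∀ i : Fin m, σ i.succ < σ i.castSucc := fun i => hσ i.castSucc_lt_succ
  have hle : ∀ i : Fin m, σ i.castSucc ≤ 0 := fun i => hσ0 ▸ hσ.antitone (Fin.zero_le _)
  have hge : ∀ i : Fin m, -‖b‖ ≤ σ i.succ := fun i => hσm ▸ hσ.antitone (Fin.le_last _)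
  have hpiece : ∀ i : Fin m, ∃ τ,
      Set.Ioo (σ i.succ) (σ i.castSucc) ⊆ Lasso.signSet (Lasso.covMatrix x) b τ := fun i =>
    Lasso.exists_Ioo_subset_signSet (hlt i) (hge i) (hle i)
      (hr ▸ PolygonalChain.disjoint_Ioo_range hσ i)
  choose τ hτ using hpiece
  have hface : ∀ i, ∀ s ∈ Set.Icc (σ i.succ) (σ i.castSucc), β s =
      Lasso.facePoint (Lasso.covMatrix x) b (Lasso.face (τ i)) (Lasso.faceSign (τ i)) s :=
    fun i => Lasso.path_eq_facePoint hK (hlt i) (hle i) (hτ i)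
  have hf := fun i s hs => (hface i s hs).trans (Lasso.facePoint_eq _ _ s)
  have hedge := PolygonalChain.edge_eq_image hσ hf
  have hinj : Set.InjOn β (Set.Icc (σ (Fin.last m)) (σ 0)) := by
    rw [hσ0, hσm]
    exact Lasso.injOn_path hK
  have hmid : ∀ i : Fin m, ∃ s, s ∈ Set.Ioo (σ i.succ) (σ i.castSucc) := fun i =>
    Set.nonempty_Ioo.2 (hlt i)
  choose r hr' using hmid
  have hrIoc : ∀ i, r i ∈ Set.Ioc (-‖b‖) 0 := fun i =>
    ⟨(hge i).trans_lt (hr' i).1, (hr' i).2.le.trans (hle i)⟩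
  have hne : ∀ i, β (r i) ≠ 0 := fun i => Lasso.path_ne_zero hK (hrIoc i)
  have hpat : ∀ i j, Lasso.pattern (β (r i)) j = τ i j := fun i => congrFun (hτ i (hr' i)).2
  have hmem : ∀ i j, j ∈ Lasso.face (τ i) ↔ β (r i) j ≠ 0 := fun i j => by
    rw [Lasso.mem_face, ← hpat, Ne, Lasso.pattern_apply_eq_zero]
  refine ⟨fun γ => Lasso.isLeastSquares_iff_eq_center hx, -‖b‖, β,
    fun s hs γ => Lasso.isLassoSolutionAt_iff_eq_lassoPath hx hs, Lasso.strictMonoOn_l1_path hK,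
    Lasso.image_l1_path hK, fun s hs γ => Lasso.isLassoSolution_iff_eq_lassoPath hx hs.2,
    m, σ, β ∘ σ, hσ, hσ0, hσm, fun i => rfl, ?_, ?_,
    PolygonalChain.isSimple_of_injOn hσ hinj hf, ?_, ?_, fun i =>
    ⟨Lasso.face (τ i), Lasso.faceSign (τ i), ?_, Lasso.faceSign_eq (τ i), ?_, hface i, ?_⟩⟩
  · rw [Function.comp_apply, hσ0]
    exact Lasso.path_zero hK
  · rw [Function.comp_apply, hσm]
    exact Lasso.path_neg_norm hK
  · rw [← hσ0, ← hσm]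
    exact PolygonalChain.image_Icc_eq_trace hσ hf
  · have hlt_case : ∀ i j : Fin m, i < j →
        Lasso.pattern (β (r j)) ≠ Lasso.pattern (β (r i)) := fun i j hij => by
      refine Lasso.pattern_ne_of_breakpoint hK (r := σ i.succ) (hr ▸ Set.mem_range_self _)
        (Set.Ioc_subset_Icc_self (hrIoc j)) (Set.Ioc_subset_Icc_self (hrIoc i)) ?_ (hr' i).1
      exact (hr' j).2.trans_le (hσ.antitone (Fin.succ_le_castSucc_iff.2 hij))
    intro i j hij hpar
    obtain ⟨c, hc⟩ := PolygonalChain.exists_smul_eq_of_parallel hσ hf hpar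
    have hsupp : ∀ i j, β (r i) j = 0 → Lasso.extendZero (Lasso.face (τ i))
        ((Lasso.faceMatrix (Lasso.covMatrix x) (Lasso.face (τ i)))⁻¹.mulVec
          (Lasso.faceSign (τ i))) j = 0 := fun i j h => by
      rw [Lasso.extendZero, dif_neg]
      rw [hmem]
      exact not_not.2 h
    have hgrad : ∀ i j, β (r i) j ≠ 0 → ((Lasso.covMatrix x).mulVec
        (Lasso.extendZero (Lasso.face (τ i))
        ((Lasso.faceMatrix (Lasso.covMatrix x) (Lasso.face (τ i)))⁻¹.mulVec
          (Lasso.faceSign (τ i))))) j = SignType.sign (β (r i) j) := fun i j h => by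
      rw [Lasso.mulVec_extendZero_inv hK _ _ ⟨j, (hmem i j).2 h⟩, Lasso.faceSign, ← hpat]
      rfl
    have hpp := Lasso.pattern_eq_of_smul_eq hK (hrIoc i).2 (hrIoc j).2
      (Lasso.path_spec hK (hrIoc i).2) (Lasso.path_spec hK (hrIoc j).2) (hne i) (hne j) hc
      (hsupp i) (hgrad i) (hsupp j) (hgrad j)
    rcases lt_or_gt_of_ne hij with h | h
    · exact hlt_case i j h hpp.symm
    · exact hlt_case j i h hpp
  · obtain ⟨j, hj⟩ := Function.ne_iff.1 (hne i)
    exact ⟨j, (hmem i j).2 hj⟩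
  · rw [hedge]
    rintro _ ⟨s, hs, rfl⟩
    rw [hface i s hs]
    exact Set.mem_image_of_mem _ ⟨s, hs.2.trans (hle i), rfl⟩
  · intro s hs j
    have h1 : SignType.sign (β s j) = τ i j := congrFun (hτ i hs).2 j
    have h2 : β s j ≠ 0 := fun h => Lasso.mem_face.1 j.2 (by rw [← h1, h, sign_zero])
    rw [Lasso.faceSign, ← h1, sign_mul_self]
    exact abs_pos.2 h2
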